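/- Let $n, m \ge 1$ and $k \ge 0$ be integers and $\epsilon > 0$. A vector $\mathbf{x} \in \mathbb{R}^n$ is $k$-sparse if it has at most $k$ nonzero coordinates, and $\operatorname{sign}$ acts coordinatewise with values in $\{-1,0,1\}$, $\operatorname{sign}(0)=0$. A matrix $A \in \mathbb{R}^{m\times n}$ is a universal $\epsilon$-approximate recovery matrix for $k$-sparse vectors in $\mathbb{R}^n$ if there is a decoding function $f : \{-1,0,1\}^m \to \mathbb{R}^n$ such that, for every nonzero $k$-sparse $\mathbf{x} \in \mathbb{R}^n$, $f(\operatorname{sign}(A\mathbf{x})) \ne 0$ and $$\left\| \frac{\mathbf{x}}{\|\mathbf{x}\|_2} - \frac{f(\operatorname{sign}(A\mathbf{x}))}{\|f(\operatorname{sign}(A\mathbf{x}))\|_2} \right\|_2 \le \epsilon .$$ Lemma. There is an absolute constant $C > 0$ such that for all integers $1 \le k \le n$, all $0 < \epsilon < 1$ and all integers $$m \ge C\, \frac{k}{\epsilon} \log \frac{n^{3/2}}{k\epsilon},$$ there exists a universal $\epsilon$-approximate recovery matrix $A \in \mathbb{R}^{m \times n}$ for $k$-sparse vectors in $\mathbb{R}^n$.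 Moreover, if $A \in \mathbb{R}^{m\times n}$ has i.i.d. $N(0,1)$ entries, then $A$ is such a matrix with high probability: the probability that it is not is at most $\exp(-\epsilon m / C)$ (and hence, by the bound on $m$, at most $(k\epsilon/n^{3/2})^{k}$). -/

import Mathlib

open MeasureTheory ProbabilityTheory
open scoped Matrix

/-- A vector `x ∈ ℝⁿ` is `k`-sparse if it has at most `k` nonzero coordinates. -/
def IsSparse {n : ℕ} (k : ℕ) (x : EuclideanSpace ℝ (Fin n)) : Prop :=
  {i : Fin n | x i ≠ 0}.ncard ≤ k

/-- The vector `sign (A x) ∈ {-1, 0, 1}ᵐ` of one-bit measurements of `x` (`sign 0 = 0`). -/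
noncomputable def signMeasurement {m n : ℕ} (A : Matrix (Fin m) (Fin n) ℝ)
    (x : EuclideanSpace ℝ (Fin n)) : Fin m → SignType :=
  fun i => SignType.sign ((A *ᵥ x.ofLp) i)

/-- `A` can be used for universal `ε`-approximate recovery of `k`-sparse vectors of `ℝⁿ`: one
decoding function recovers from `sign (A x)` the direction of every nonzero `k`-sparse `x`, up to
Euclidean error `ε`. The decoded vector has to be nonzero, so that it has a direction. -/
def IsUniversalApproxRecovery {m n : ℕ} (A : Matrix (Fin m) (Fin n) ℝ) (k : ℕ) (ε : ℝ) : Prop :=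
  ∃ f : (Fin m → SignType) → EuclideanSpace ℝ (Fin n),
    ∀ x : EuclideanSpace ℝ (Fin n), x ≠ 0 → IsSparse k x →
      f (signMeasurement A x) ≠ 0 ∧
      ‖(‖x‖⁻¹ • x) - (‖f (signMeasurement A x)‖⁻¹ • f (signMeasurement A x))‖ ≤ ε

/-- The law of the array of entries of an `m × n` matrix whose entries are i.i.d. `N(0,1)`. -/
noncomputable def gaussianMatrixLaw (m n : ℕ) : Measure (Fin m → Fin n → ℝ) :=
  Measure.pi fun _ : Fin m => Measure.pi fun _ : Fin n => gaussianReal 0 1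

/-! A decoder works as soon as unit sparse vectors more than `ε` apart have different sign patterns,
since it may return any consistent unit sparse vector. A Gaussian row separates two unit vectors `ε
/ 2` apart, with a margin of order `ε`, with probability at least of order `ε`
(`exists_mul_le_stdGaussian_separates`). The margin survives perturbations of size `δ` unless the
row is very long, so it is enough to separate the pairs of a `δ`-net. All `m` independent rows fail
on one pair with probability at most `exp (-c ε m)`. The net has at most `W ^ k` points with `W`
polynomial in `n / ε` (`exists_sparse_net`), and for `n ≥ 2`, `log W` is at most a multiple of `log
(n ^ (3 / 2) / (k ε))`, so the union bound over pairs closes. -/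

/-! ### Gaussian estimates for one row. -/

section Gaussian

open scoped RealInnerProductSpace

variable {E : Type*} [NormedAddCommGroup E] [InnerProductSpace ℝ E] [FiniteDimensional ℝ E]
  [MeasurableSpace E] [BorelSpace E]

lemma covariance_inner_stdGaussian (x y : E) :
    cov[fun a ↦ ⟪x, a⟫, fun a ↦ ⟪y, a⟫; stdGaussian E] = ⟪x, y⟫ := by
  rw [← covarianceBilin_apply_eq_cov IsGaussian.memLp_two_id, covarianceBilin_stdGaussian,
    innerSL_apply_apply]

/-- The inner product of a standard Gaussian vector with `x` is distributed as `‖x‖` times a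
standard Gaussian variable. -/
lemma stdGaussian_map_inner (x : E) :
    (stdGaussian E).map (fun a ↦ ⟪x, a⟫) = (gaussianReal 0 1).map (fun g ↦ ‖x‖ * g) := by
  have h := IsGaussian.map_eq_gaussianReal (μ := stdGaussian E) (innerSL ℝ x)
  rw [integral_strongDual_stdGaussian, variance_dual_stdGaussian, innerSL_apply_norm] at h
  change (stdGaussian E).map (innerSL ℝ x) = _
  rw [h, gaussianReal_map_const_mul]
  congr 1
  · simp
  · simpa using Real.toNNReal_of_nonneg (sq_nonneg ‖x‖)

lemma stdGaussian_setOf_inner (x : E) {s : Set ℝ} (hs : MeasurableSet s) :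
    stdGaussian E {a | ⟪x, a⟫ ∈ s} = gaussianReal 0 1 {g | ‖x‖ * g ∈ s} := by
  have h := congrArg (fun μ ↦ μ s) (stdGaussian_map_inner x)
  rwa [Measure.map_apply (by fun_prop) hs, Measure.map_apply (by fun_prop) hs] at h

lemma indepFun_inner_stdGaussian {x y : E} (h : ⟪x, y⟫ = 0) :
    IndepFun (fun a ↦ ⟪x, a⟫) (fun a ↦ ⟪y, a⟫) (stdGaussian E) := by
  refine HasGaussianLaw.indepFun_of_covariance_eq_zero ?_ ?_
  · exact (IsGaussian.hasGaussianLaw_id (μ := stdGaussian E)).map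
      ((innerSL ℝ x).prod (innerSL ℝ y))
  · rw [covariance_inner_stdGaussian, h]

/-- On `[-1, 1]` the density is at least its value at `1`. -/
lemma exists_mul_le_gaussianReal_Icc :
    ∃ c : ℝ, 0 < c ∧ ∀ r : ℝ, 0 ≤ r → r ≤ 1 →
      ENNReal.ofReal (c * r) ≤ gaussianReal 0 1 (Set.Icc (-r) r) := by
  refine ⟨2 * gaussianPDFReal 0 1 1, by
    have := gaussianPDFReal_pos 0 1 1 one_ne_zero; positivity, fun r hr0 hr1 ↦ ?_⟩
  rw [gaussianReal_apply 0 one_ne_zero]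
  calc ENNReal.ofReal (2 * gaussianPDFReal 0 1 1 * r)
      = ∫⁻ _ in Set.Icc (-r) r, gaussianPDF 0 1 1 := by
        rw [lintegral_const, Measure.restrict_apply_univ, Real.volume_Icc, gaussianPDF,
          ← ENNReal.ofReal_mul (gaussianPDFReal_nonneg 0 1 1)]
        congr 1; ring
    _ ≤ ∫⁻ x in Set.Icc (-r) r, gaussianPDF 0 1 x := by
        refine setLIntegral_mono (measurable_gaussianPDF 0 1) fun x hx ↦ ?_
        refine ENNReal.ofReal_le_ofReal ?_
        simp only [gaussianPDFReal]
        gcongr ?_ * Real.exp ?_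
        have : x ^ 2 ≤ 1 := by nlinarith [hx.1, hx.2]
        simp only [sub_zero, NNReal.coe_one]
        linarith

lemma gaussianReal_Ici_pos : 0 < gaussianReal 0 1 (Set.Ici 1) := by
  rw [pos_iff_ne_zero]
  intro h
  have := gaussianReal_absolutelyContinuous' 0 (one_ne_zero (α := NNReal)) h
  simp at this

/-- A Gaussian hyperplane separates two unit vectors with a margin proportional to their distance
with probability at least proportional to that distance. -/
lemma exists_mul_le_stdGaussian_separates :
    ∃ c : ℝ, 0 < c ∧ ∀ (E : Type) [NormedAddCommGroup E] [InnerProductSpace ℝ E]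
      [FiniteDimensional ℝ E] [MeasurableSpace E] [BorelSpace E] (x y : E) (η : ℝ),
      ‖x‖ = 1 → ‖y‖ = 1 → 0 < η → η ≤ 1 → η ≤ ‖x - y‖ →
      ENNReal.ofReal (c * η) ≤ stdGaussian E {a | η / 4 < ⟪x, a⟫ ∧ ⟪y, a⟫ < -(η / 4)} := by
  obtain ⟨c, hc, hIcc⟩ := exists_mul_le_gaussianReal_Icc
  set p := (gaussianReal 0 1 (Set.Ici 1)).toReal with hp
  have hp0 : 0 < p := ENNReal.toReal_pos gaussianReal_Ici_pos.ne' (measure_ne_top _ _)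
  have hp' : gaussianReal 0 1 (Set.Ici 1) = ENNReal.ofReal p :=
    (ENNReal.ofReal_toReal (measure_ne_top _ _)).symm
  refine ⟨c * p / 8, by positivity, ?_⟩
  intro E _ _ _ _ _ x y η hx hy hη hη1 hxy
  -- Equal norms make `x + y` and `x - y` orthogonal, hence their products with `a` independent. A
  -- small sum (probability of order `η`) and a large difference (constant probability) force
  -- opposite signs with margin `3 η / 8`.
  have horth : ⟪x + y, x - y⟫ = 0 := by
    rw [real_inner_add_sub_eq_zero_iff, hx, hy]
  have hind := indepFun_inner_stdGaussian horth
  have hS : ENNReal.ofReal (c * (η / 8)) ≤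
      stdGaussian E {a | ⟪x + y, a⟫ ∈ Set.Icc (-(η / 4)) (η / 4)} := by
    rw [stdGaussian_setOf_inner _ measurableSet_Icc]
    refine (hIcc (η / 8) (by positivity) (by linarith)).trans (measure_mono fun g hg ↦ ?_)
    have h2 : ‖x + y‖ ≤ 2 := (norm_add_le _ _).trans (by rw [hx, hy]; norm_num)
    have hg' : |g| ≤ η / 8 := abs_le.2 hg
    have : |‖x + y‖ * g| ≤ η / 4 := by
      rw [abs_mul, abs_norm]
      nlinarith [mul_le_mul h2 hg' (abs_nonneg g) zero_le_two]
    exact abs_le.1 this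
  have hD : ENNReal.ofReal p ≤ stdGaussian E {a | ⟪x - y, a⟫ ∈ Set.Ici ‖x - y‖} := by
    rw [stdGaussian_setOf_inner _ measurableSet_Ici, ← hp']
    refine measure_mono fun g hg ↦ ?_
    exact le_mul_of_one_le_right (norm_nonneg _) hg
  calc ENNReal.ofReal (c * p / 8 * η)
      ≤ ENNReal.ofReal (c * (η / 8)) * ENNReal.ofReal p := by
        rw [← ENNReal.ofReal_mul (by positivity)]
        refine ENNReal.ofReal_le_ofReal (le_of_eq ?_)
        ring
    _ ≤ _ := mul_le_mul' hS hD
    _ = stdGaussian E ({a | ⟪x + y, a⟫ ∈ Set.Icc (-(η / 4)) (η / 4)} ∩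
          {a | ⟪x - y, a⟫ ∈ Set.Ici ‖x - y‖}) :=
        (hind.measure_inter_preimage_eq_mul _ _ measurableSet_Icc measurableSet_Ici).symm
    _ ≤ _ := by
        refine measure_mono fun a ha ↦ ?_
        obtain ⟨⟨h1, h2⟩, h3⟩ := ha
        simp only [Set.mem_ofPred_eq, Set.mem_Ici, inner_add_left, inner_sub_left] at h1 h2 h3
        constructor <;> linarith

lemma stdGaussian_setOf_lt_norm_le {n : ℕ} {R : ℝ} (hR : 0 < R) :
    stdGaussian (EuclideanSpace ℝ (Fin n)) {a | R < ‖a‖} ≤ ENNReal.ofReal (n / R ^ 2) := by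
  set μ := stdGaussian (EuclideanSpace ℝ (Fin n))
  have hi (i : Fin n) : Integrable (fun a : EuclideanSpace ℝ (Fin n) ↦ a i ^ 2) μ :=
    ((IsGaussian.memLp_two_id (μ := μ)).continuousLinearMap_comp
      (EuclideanSpace.proj (𝕜 := ℝ) i)).integrable_sq
  have hint : Integrable (fun a : EuclideanSpace ℝ (Fin n) ↦ ‖a‖ ^ 2) μ := by
    simp_rw [EuclideanSpace.real_norm_sq_eq]
    exact integrable_finsetSum _ fun i _ ↦ hi i
  have hval (i : Fin n) : ∫ a, a i ^ 2 ∂μ = 1 := by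
    have h1 := variance_dual_stdGaussian (E := EuclideanSpace ℝ (Fin n))
      (innerSL ℝ (EuclideanSpace.single i 1))
    rw [variance_of_integral_eq_zero (by fun_prop) (integral_strongDual_stdGaussian _),
      innerSL_apply_norm] at h1
    simpa [EuclideanSpace.inner_single_left] using h1
  have hsum : ∫ a, ‖a‖ ^ 2 ∂μ = n := by
    simp_rw [EuclideanSpace.real_norm_sq_eq]
    rw [integral_finsetSum _ fun i _ ↦ hi i]
    simp [hval]
  have hM := mul_meas_ge_le_integral_of_nonneg (μ := μ)
    (Filter.Eventually.of_forall fun a ↦ sq_nonneg ‖a‖) hint (R ^ 2)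
  rw [hsum] at hM
  calc μ {a | R < ‖a‖} ≤ μ {a | R ^ 2 ≤ ‖a‖ ^ 2} := by
        refine measure_mono fun a ha ↦ ?_
        exact pow_le_pow_left₀ hR.le (le_of_lt ha) 2
    _ = ENNReal.ofReal (μ.real {a | R ^ 2 ≤ ‖a‖ ^ 2}) := by simp
    _ ≤ _ := ENNReal.ofReal_le_ofReal ((le_div_iff₀' (by positivity)).2 hM)

end Gaussian

/-! ### A net of the unit sparse vectors. -/

section Net

/-- One point is kept per label in use. Representatives lie in `S` itself, so net points are genuine
unit vectors. -/
lemma exists_finset_representatives {α I : Type*} [Fintype I] (S : Set α) (R : α → I → Prop)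
    (h : ∀ x ∈ S, ∃ i, R x i) :
    ∃ N : Finset α, (N : Set α) ⊆ S ∧ N.card ≤ Fintype.card I ∧
      ∀ x ∈ S, ∃ y ∈ N, ∃ i, R x i ∧ R y i := by
  classical
  choose f hf using fun x : S ↦ h x x.2
  obtain ⟨s, -, hs⟩ := Set.exists_subset_bijOn Set.univ f
  have hfin : s.Finite := Set.Finite.of_finite_image (Set.toFinite _) hs.injOn
  refine ⟨hfin.toFinset.image Subtype.val, ?_, ?_, ?_⟩
  · intro x hx
    obtain ⟨y, -, rfl⟩ := Finset.mem_image.1 (Finset.mem_coe.1 hx)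
    exact y.2
  · refine Finset.card_image_le.trans ?_
    exact Finset.card_le_card_of_injOn f (t := Finset.univ) (by simp [Set.MapsTo])
      (by simpa using hs.injOn)
  · intro x hx
    obtain ⟨y, hy, hxy⟩ := hs.surjOn (Set.mem_image_of_mem f (Set.mem_univ ⟨x, hx⟩))
    exact ⟨y, Finset.mem_image.2 ⟨y, by simpa using hy, rfl⟩, f ⟨x, hx⟩, hf ⟨x, hx⟩, hxy ▸ hf y⟩

lemma IsSparse.exists_support_subset_range {n k : ℕ} {x : EuclideanSpace ℝ (Fin n)}
    (hx : IsSparse k x) (hx0 : x ≠ 0) : ∃ e : Fin k → Fin n, ∀ i, x i ≠ 0 → ∃ j, e j = i := by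
  classical
  have hne : Nonempty {i : Fin n // x i ≠ 0} := by
    by_contra h
    refine hx0 (PiLp.ext fun i ↦ ?_)
    by_contra hi
    exact h ⟨i, hi⟩
  obtain ⟨g⟩ : Nonempty ({i : Fin n // x i ≠ 0} ↪ Fin k) := by
    refine Function.Embedding.nonempty_of_card_le ?_
    rw [Fintype.card_fin, ← Nat.card_eq_fintype_card]
    exact hx
  exact ⟨fun j ↦ (Function.invFun g j).1, fun i hi ↦
    ⟨g ⟨i, hi⟩, congrArg Subtype.val (Function.leftInverse_invFun g.injective ⟨i, hi⟩)⟩⟩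

lemma abs_sub_le_inv_of_floor_eq {M a b : ℝ} (hM : 0 < M) (h : ⌊M * a⌋ = ⌊M * b⌋) :
    |a - b| ≤ M⁻¹ := by
  have h1 := Int.abs_sub_lt_one_of_floor_eq_floor h
  rw [← mul_sub, abs_mul, abs_of_pos hM] at h1
  rw [← one_div, le_div_iff₀' hM]
  exact h1.le

/-- The unit `k`-sparse vectors have a net of cardinality at most `(n (2 M + 1)) ^ k` and of mesh
`√n / M`. -/
lemma exists_sparse_net (n k : ℕ) {M : ℕ} (hM : 0 < M) :
    ∃ N : Finset (EuclideanSpace ℝ (Fin n)), N.card ≤ (n * (2 * M + 1)) ^ k ∧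
      (∀ x ∈ N, ‖x‖ = 1) ∧
      ∀ x : EuclideanSpace ℝ (Fin n), ‖x‖ = 1 → IsSparse k x →
        ∃ y ∈ N, ‖x - y‖ ^ 2 ≤ n / (M : ℝ) ^ 2 := by
  have hM' : (0 : ℝ) < M := by exact_mod_cast hM
  -- A label lists `k` coordinates covering the support, possibly with repetitions, and the value at
  -- each rounded down to the grid of step `1 / M`.
  obtain ⟨N, hNS, hNc, hN⟩ := exists_finset_representatives
    (I := Fin k → Fin n × (Finset.Icc (-(M : ℤ)) M))
    {x : EuclideanSpace ℝ (Fin n) | ‖x‖ = 1 ∧ IsSparse k x}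
    (fun x q ↦ (∀ i, x i ≠ 0 → ∃ j, (q j).1 = i) ∧
      ∀ j, ((q j).2 : ℤ) = ⌊(M : ℝ) * x (q j).1⌋) (by
    rintro x ⟨hx1, hxk⟩
    obtain ⟨e, he⟩ := hxk.exists_support_subset_range (norm_ne_zero_iff.1 (by rw [hx1]; simp))
    have hb (i : Fin n) : |x i| ≤ 1 := by
      have := PiLp.norm_apply_le x i
      rwa [hx1, Real.norm_eq_abs] at this
    refine ⟨fun j ↦ (e j, ⟨⌊(M : ℝ) * x (e j)⌋, ?_⟩), he, fun j ↦ rfl⟩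
    have hj := abs_le.1 (hb (e j))
    rw [Finset.mem_Icc, Int.le_floor]
    constructor
    · push_cast
      nlinarith [hj.1]
    · refine Int.floor_le_iff.2 ?_
      push_cast
      nlinarith [hj.2])
  refine ⟨N, ?_, fun x hx ↦ (hNS hx).1, fun x hx1 hxk ↦ ?_⟩
  · refine hNc.trans (le_of_eq ?_)
    simp only [Fintype.card_pi, Fintype.card_prod, Fintype.card_fin, Fintype.card_coe,
      Int.card_Icc, Finset.prod_const, Finset.card_univ]
    congr 2
    omega
  · obtain ⟨y, hy, q, ⟨hx, hxq⟩, hy', hyq⟩ := hN x ⟨hx1, hxk⟩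
    refine ⟨y, hy, ?_⟩
    have hcoord (i : Fin n) : |x i - y i| ≤ (M : ℝ)⁻¹ := by
      by_cases h : ∃ j, (q j).1 = i
      · obtain ⟨j, rfl⟩ := h
        exact abs_sub_le_inv_of_floor_eq hM' ((hxq j).symm.trans (hyq j))
      · have h1 : x i = 0 := by_contra fun h0 ↦ h (hx i h0)
        have h2 : y i = 0 := by_contra fun h0 ↦ h (hy' i h0)
        rw [h1, h2]
        simp
    rw [EuclideanSpace.real_norm_sq_eq]
    calc ∑ i, (x - y) i ^ 2 ≤ ∑ _i : Fin n, ((M : ℝ)⁻¹) ^ 2 := by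
          refine Finset.sum_le_sum fun i _ ↦ ?_
          rw [PiLp.sub_apply, ← sq_abs]
          exact pow_le_pow_left₀ (abs_nonneg _) (hcoord i) 2
      _ = n / (M : ℝ) ^ 2 := by simp [div_eq_mul_inv]

end Net

/-! ### Deterministic reduction to separating net points. -/

section Recovery

lemma IsSparse.smul {n k : ℕ} {x : EuclideanSpace ℝ (Fin n)} (hx : IsSparse k x) (c : ℝ) :
    IsSparse k (c • x) :=
  (Set.ncard_le_ncard fun i (hi : c * x i ≠ 0) ↦ right_ne_zero_of_mul hi).trans hx

lemma signMeasurement_smul {m n : ℕ} (A : Matrix (Fin m) (Fin n) ℝ)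
    (x : EuclideanSpace ℝ (Fin n)) {c : ℝ} (hc : 0 < c) :
    signMeasurement A (c • x) = signMeasurement A x := by
  funext i
  simp only [signMeasurement, WithLp.ofLp_smul, Matrix.mulVec_smul, Pi.smul_apply, smul_eq_mul,
    sign_mul, sign_pos hc, one_mul]

/-- If unit sparse vectors with the same sign measurements are at distance at most `ε`, then the
matrix is a universal approximate recovery matrix. -/
lemma isUniversalApproxRecovery_of_unit {m n k : ℕ} {ε : ℝ} (A : Matrix (Fin m) (Fin n) ℝ)
    (h : ∀ x y : EuclideanSpace ℝ (Fin n), ‖x‖ = 1 → ‖y‖ = 1 → IsSparse k x → IsSparse k y →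
      signMeasurement A x = signMeasurement A y → ‖x - y‖ ≤ ε) :
    IsUniversalApproxRecovery A k ε := by
  classical
  let P (s : Fin m → SignType) (y : EuclideanSpace ℝ (Fin n)) : Prop :=
    ‖y‖ = 1 ∧ IsSparse k y ∧ signMeasurement A y = s
  -- The value `0` is never taken on the measurements of a nonzero sparse vector, as its
  -- normalization is a candidate.
  refine ⟨fun s ↦ if hs : ∃ y, P s y then hs.choose else 0, fun x hx0 hxk ↦ ?_⟩
  have hnx : 0 < ‖x‖⁻¹ := inv_pos.2 (norm_pos_iff.2 hx0)
  have hu1 : ‖‖x‖⁻¹ • x‖ = 1 := by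
    rw [norm_smul, norm_inv, norm_norm, inv_mul_cancel₀ (norm_ne_zero_iff.2 hx0)]
  have hs : ∃ y, P (signMeasurement A x) y :=
    ⟨‖x‖⁻¹ • x, hu1, hxk.smul _, signMeasurement_smul A x hnx⟩
  beta_reduce
  rw [dif_pos hs]
  obtain ⟨h1, h2, h3⟩ := hs.choose_spec
  refine ⟨norm_ne_zero_iff.1 (by rw [h1]; exact one_ne_zero), ?_⟩
  rw [h1, inv_one, one_smul]
  exact h _ _ hu1 h1 (hxk.smul _) h2 ((signMeasurement_smul A x hnx).trans h3.symm)

open scoped RealInnerProductSpace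

lemma signMeasurement_of_apply {m n : ℕ} (a : Fin m → Fin n → ℝ) (x : EuclideanSpace ℝ (Fin n))
    (i : Fin m) :
    signMeasurement (Matrix.of a) x i = SignType.sign ⟪x, WithLp.toLp 2 (a i)⟫ := by
  simp [signMeasurement, Matrix.mulVec, PiLp.inner_apply, dotProduct]

/-- The rows that separate the `δ`-balls around `x` and `y`, certified by a margin `t`. -/
def separatingRows {E : Type*} [NormedAddCommGroup E] [InnerProductSpace ℝ E] (t δ : ℝ)
    (x y : E) : Set E :=
  {a | t < ⟪x, a⟫ ∧ ⟪y, a⟫ < -t ∧ δ * ‖a‖ ≤ t}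

lemma measurableSet_separatingRows {E : Type*} [NormedAddCommGroup E] [InnerProductSpace ℝ E]
    [MeasurableSpace E] [BorelSpace E] (t δ : ℝ) (x y : E) :
    MeasurableSet (separatingRows t δ x y) := by
  have h1 : IsOpen {a : E | t < ⟪x, a⟫} := isOpen_lt (by fun_prop) (by fun_prop)
  have h2 : IsOpen {a : E | ⟪y, a⟫ < -t} := isOpen_lt (by fun_prop) (by fun_prop)
  have h3 : IsClosed {a : E | δ * ‖a‖ ≤ t} := isClosed_le (by fun_prop) (by fun_prop)
  exact h1.measurableSet.inter (h2.measurableSet.inter h3.measurableSet)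

lemma inner_pos_neg_of_mem_separatingRows {E : Type*} [NormedAddCommGroup E]
    [InnerProductSpace ℝ E] {t δ : ℝ} {x y x' y' a : E} (ha : a ∈ separatingRows t δ x y)
    (hx : ‖x' - x‖ ≤ δ) (hy : ‖y' - y‖ ≤ δ) : 0 < ⟪x', a⟫ ∧ ⟪y', a⟫ < 0 := by
  obtain ⟨h1, h2, h3⟩ := ha
  have key (u v : E) (h : ‖u - v‖ ≤ δ) : |⟪u, a⟫ - ⟪v, a⟫| ≤ t := by
    rw [← inner_sub_left]
    exact (abs_real_inner_le_norm _ _).trans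
      ((mul_le_mul_of_nonneg_right h (norm_nonneg a)).trans h3)
  have kx := abs_le.1 (key _ _ hx)
  have ky := abs_le.1 (key _ _ hy)
  constructor <;> linarith [kx.1, ky.2]

/-- If every two distant points of a net of the unit sparse vectors are separated by some row, the
matrix is a universal approximate recovery matrix. -/
lemma isUniversalApproxRecovery_of_net {m n k : ℕ} {ε t δ : ℝ} (a : Fin m → Fin n → ℝ)
    (N : Finset (EuclideanSpace ℝ (Fin n))) (hδ : δ ≤ ε / 4)
    (hN : ∀ x : EuclideanSpace ℝ (Fin n), ‖x‖ = 1 → IsSparse k x → ∃ y ∈ N, ‖x - y‖ ≤ δ)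
    (h : ∀ x ∈ N, ∀ y ∈ N, ε / 2 ≤ ‖x - y‖ →
      ∃ i, WithLp.toLp 2 (a i) ∈ separatingRows t δ x y) :
    IsUniversalApproxRecovery (Matrix.of a) k ε := by
  refine isUniversalApproxRecovery_of_unit _ fun x y hx hy hxk hyk hxy ↦ ?_
  by_contra! hε
  obtain ⟨x', hx'N, hx'⟩ := hN x hx hxk
  obtain ⟨y', hy'N, hy'⟩ := hN y hy hyk
  -- Each of the two approximations costs at most `ε / 4`.
  have hd : ε / 2 ≤ ‖x' - y'‖ := by
    have h1 : ‖x - y‖ ≤ ‖x - x'‖ + ‖x' - y'‖ + ‖y - y'‖ := by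
      calc ‖x - y‖ = ‖(x - x') + (x' - y') - (y - y')‖ := by congr 1; abel
        _ ≤ _ := (norm_sub_le _ _).trans (by gcongr; exact norm_add_le _ _)
    linarith
  obtain ⟨i, hi⟩ := h x' hx'N y' hy'N hd
  obtain ⟨h1, h2⟩ := inner_pos_neg_of_mem_separatingRows hi hx' hy'
  have := congrFun hxy i
  rw [signMeasurement_of_apply, signMeasurement_of_apply, sign_pos h1, sign_neg h2] at this
  exact absurd this (by decide)

end Recovery

/-! ### Union bound, and the constants. -/

section Probability

/-- Separation at `η = ε / 2` has probability at least of order `ε`. By Markov applied to `‖a‖ ^ 2`,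
of mean `n`, the row is too long with probability at most `64 n δ ^ 2 / ε ^ 2`; the choice of `B`
makes this at most half of the former. -/
lemma exists_mul_le_stdGaussian_separatingRows :
    ∃ c B : ℝ, 0 < c ∧ 0 < B ∧ ∀ (n : ℕ) (x y : EuclideanSpace ℝ (Fin n)) (ε δ : ℝ),
      ‖x‖ = 1 → ‖y‖ = 1 → 0 < ε → ε < 1 → 0 < δ → B * (n * δ ^ 2) ≤ ε ^ 3 → ε / 2 ≤ ‖x - y‖ →
      ENNReal.ofReal (c * ε) ≤
        stdGaussian (EuclideanSpace ℝ (Fin n)) (separatingRows (ε / 8) δ x y) := by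
  obtain ⟨c, hc, h⟩ := exists_mul_le_stdGaussian_separates
  refine ⟨c / 4, 256 / c, by positivity, by positivity, ?_⟩
  intro n x y ε δ hx hy hε hε1 hδ hB hxy
  have h1 := h (EuclideanSpace ℝ (Fin n)) x y (ε / 2) hx hy (by positivity) (by linarith) hxy
  have h2 := stdGaussian_setOf_lt_norm_le (n := n) (R := ε / 8 / δ) (by positivity)
  have h3 : (n : ℝ) / (ε / 8 / δ) ^ 2 ≤ c * ε / 4 := by
    have hB' : 256 * (n * δ ^ 2) ≤ c * ε ^ 3 := by
      rw [div_mul_eq_mul_div, div_le_iff₀ hc] at hB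
      linarith
    rw [div_pow, div_div_eq_mul_div, div_le_iff₀ (by positivity)]
    linarith
  have hsub : {a : EuclideanSpace ℝ (Fin n) | ε / 2 / 4 < inner ℝ x a ∧
      inner ℝ y a < -(ε / 2 / 4)} ⊆
      separatingRows (ε / 8) δ x y ∪ {a | ε / 8 / δ < ‖a‖} := by
    rintro a ⟨ha1, ha2⟩
    by_cases ha : ε / 8 / δ < ‖a‖
    · exact Or.inr ha
    · refine Or.inl ⟨by linarith, by linarith, ?_⟩
      rwa [not_lt, le_div_iff₀' hδ] at ha
  have h4 := (h1.trans (measure_mono hsub)).trans (measure_union_le _ _)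
  calc ENNReal.ofReal (c / 4 * ε)
      = ENNReal.ofReal (c * (ε / 2)) - ENNReal.ofReal (c * ε / 4) := by
        rw [← ENNReal.ofReal_sub _ (by positivity)]
        congr 1; ring
    _ ≤ _ := tsub_le_iff_right.2
        (h4.trans (add_le_add_right (h2.trans (ENNReal.ofReal_le_ofReal h3)) _))

lemma gaussianMatrixLaw_forall_row_notMem_le {m n : ℕ} {G : Set (EuclideanSpace ℝ (Fin n))}
    (hG : MeasurableSet G) {p : ℝ} (hp : 0 ≤ p)
    (h : ENNReal.ofReal p ≤ stdGaussian (EuclideanSpace ℝ (Fin n)) G) :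
    gaussianMatrixLaw m n {a | ∀ i, WithLp.toLp 2 (a i) ∉ G} ≤
      ENNReal.ofReal (Real.exp (-(p * m))) := by
  have hset : {a : Fin m → Fin n → ℝ | ∀ i, WithLp.toLp 2 (a i) ∉ G} =
      Set.univ.pi fun _ ↦ WithLp.toLp 2 ⁻¹' Gᶜ := by
    ext a; simp
  have hrow : (Measure.pi fun _ : Fin n ↦ gaussianReal 0 1) (WithLp.toLp 2 ⁻¹' Gᶜ) ≤
      ENNReal.ofReal (Real.exp (-p)) := by
    rw [← Measure.map_apply (by fun_prop) hG.compl, map_pi_eq_stdGaussian, prob_compl_eq_one_sub hG]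
    calc 1 - stdGaussian (EuclideanSpace ℝ (Fin n)) G ≤ 1 - ENNReal.ofReal p :=
          tsub_le_tsub_left h 1
      _ = ENNReal.ofReal (1 - p) := by rw [ENNReal.ofReal_sub _ hp, ENNReal.ofReal_one]
      _ ≤ _ := ENNReal.ofReal_le_ofReal (Real.one_sub_le_exp_neg p)
  rw [hset, gaussianMatrixLaw, Measure.pi_pi, Finset.prod_const, Finset.card_univ,
    Fintype.card_fin]
  calc _ ≤ ENNReal.ofReal (Real.exp (-p)) ^ m := pow_le_pow_left' hrow m
    _ = _ := by
      rw [← ENNReal.ofReal_pow (Real.exp_nonneg _), ← Real.exp_nat_mul]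
      congr 2; ring

/-- The union bound over the pairs of points of a net of mesh `√n / M`. -/
lemma exists_gaussianMatrixLaw_not_recovery_le :
    ∃ c B : ℝ, 0 < c ∧ 1 ≤ B ∧ ∀ (n k m M : ℕ) (ε : ℝ), 1 ≤ n → 0 < M → 0 < ε → ε < 1 →
      B * n ^ 2 ≤ ε ^ 3 * M ^ 2 →
      gaussianMatrixLaw m n
          {a : Fin m → Fin n → ℝ | ¬ IsUniversalApproxRecovery (Matrix.of a) k ε} ≤
        ENNReal.ofReal (((n * (2 * M + 1) : ℝ) ^ k) ^ 2 * Real.exp (-(c * ε * m))) := by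
  classical
  obtain ⟨c, B, hc, hB, hrows⟩ := exists_mul_le_stdGaussian_separatingRows
  -- The `16` forces the mesh below `ε / 4`.
  refine ⟨c, max 16 B, hc, (by norm_num : (1 : ℝ) ≤ 16).trans (le_max_left _ _), ?_⟩
  intro n k m M ε hn hM hε hε1 hnM
  have hM' : (0 : ℝ) < M := by exact_mod_cast hM
  have hn' : (1 : ℝ) ≤ n := by exact_mod_cast hn
  obtain ⟨N, hNc, hN1, hN⟩ := exists_sparse_net n k hM
  set δ : ℝ := √(n / (M : ℝ) ^ 2) with hδ
  have hδ0 : 0 < δ := Real.sqrt_pos.2 (by positivity)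
  have hδ2 : δ ^ 2 = n / (M : ℝ) ^ 2 := Real.sq_sqrt (by positivity)
  have hBδ : B * (n * δ ^ 2) ≤ ε ^ 3 := by
    rw [hδ2, ← mul_div_assoc, ← mul_div_assoc, div_le_iff₀ (by positivity)]
    nlinarith [le_max_right 16 B, sq_nonneg (n : ℝ)]
  have hδε : δ ≤ ε / 4 := by
    refine Real.sqrt_le_iff.2 ⟨by positivity, ?_⟩
    rw [div_le_iff₀ (by positivity)]
    have h1 : 16 * (n : ℝ) ≤ max 16 B * n ^ 2 := by
      have := le_max_left 16 B
      nlinarith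
    have h2 : ε ^ 3 * (M : ℝ) ^ 2 ≤ ε ^ 2 * M ^ 2 := by
      gcongr ?_ * _
      exact pow_le_pow_of_le_one hε.le hε1.le (by norm_num)
    linarith
  have hsub : {a : Fin m → Fin n → ℝ | ¬ IsUniversalApproxRecovery (Matrix.of a) k ε} ⊆
      ⋃ q ∈ (N ×ˢ N).filter fun q ↦ ε / 2 ≤ ‖q.1 - q.2‖,
        {a | ∀ i, WithLp.toLp 2 (a i) ∉ separatingRows (ε / 8) δ q.1 q.2} := by
    intro a ha
    by_contra hnot
    refine ha (isUniversalApproxRecovery_of_net (t := ε / 8) a N hδε (fun x hx hxk ↦ ?_)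
      fun x hx y hy hxy ↦ ?_)
    · obtain ⟨y, hy, hxy⟩ := hN x hx hxk
      exact ⟨y, hy, Real.le_sqrt_of_sq_le hxy⟩
    · by_contra! hno
      exact hnot (Set.mem_biUnion (x := (x, y)) (by simp [hx, hy, hxy]) hno)
  calc _ ≤ _ := measure_mono hsub
    _ ≤ ∑ q ∈ (N ×ˢ N).filter fun q ↦ ε / 2 ≤ ‖q.1 - q.2‖, gaussianMatrixLaw m n
          {a | ∀ i, WithLp.toLp 2 (a i) ∉ separatingRows (ε / 8) δ q.1 q.2} :=
        measure_biUnion_finset_le _ _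
    _ ≤ ∑ q ∈ (N ×ˢ N).filter fun q ↦ ε / 2 ≤ ‖q.1 - q.2‖,
          ENNReal.ofReal (Real.exp (-(c * ε * m))) := by
        refine Finset.sum_le_sum fun q hq ↦ ?_
        rw [Finset.mem_filter, Finset.mem_product] at hq
        exact gaussianMatrixLaw_forall_row_notMem_le (measurableSet_separatingRows _ _ _ _)
          (by positivity)
          (hrows n _ _ ε δ (hN1 _ hq.1.1) (hN1 _ hq.1.2) hε hε1 hδ0 hBδ hq.2)
    _ = ENNReal.ofReal (((N ×ˢ N).filter fun q ↦ ε / 2 ≤ ‖q.1 - q.2‖).card *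
          Real.exp (-(c * ε * m))) := by
        rw [Finset.sum_const, nsmul_eq_mul, ENNReal.ofReal_mul (Nat.cast_nonneg _),
          ENNReal.ofReal_natCast]
    _ ≤ _ := by
        refine ENNReal.ofReal_le_ofReal (mul_le_mul_of_nonneg_right ?_ (Real.exp_nonneg _))
        have h1 : ((N ×ˢ N).filter fun q ↦ ε / 2 ≤ ‖q.1 - q.2‖).card ≤
            ((n * (2 * M + 1)) ^ k) ^ 2 := by
          refine (Finset.card_filter_le _ _).trans ?_
          rw [Finset.card_product, ← sq]
          exact Nat.pow_le_pow_left hNc 2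
        exact_mod_cast h1

/-- Dimension one is treated apart: there `log (1 / ε)` tends to `0` as `ε → 1` while the net bound
does not, so the union bound is too weak. The only unit vectors are `±1`, and any nonzero entry
tells them apart. -/
lemma isUniversalApproxRecovery_of_entry_ne_zero {m k : ℕ} {ε : ℝ} (hε : 0 ≤ ε)
    (a : Fin m → Fin 1 → ℝ) (i : Fin m) (hi : a i 0 ≠ 0) :
    IsUniversalApproxRecovery (Matrix.of a) k ε := by
  refine isUniversalApproxRecovery_of_unit _ fun x y hx hy _ _ hxy ↦ ?_
  have hs : SignType.sign (x 0) = SignType.sign (y 0) := by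
    have h := congrFun hxy i
    have hs0 : SignType.sign (a i 0) ≠ 0 := sign_ne_zero.2 hi
    simp only [signMeasurement, Matrix.mulVec, Matrix.of_apply, dotProduct, Finset.univ_unique,
      Fin.default_eq_zero, Finset.sum_singleton, sign_mul] at h
    exact mul_left_cancel₀ hs0 h
  have habs (z : EuclideanSpace ℝ (Fin 1)) (hz : ‖z‖ = 1) : |z 0| = 1 := by
    rw [EuclideanSpace.norm_eq] at hz
    simpa [abs_eq] using hz
  have hxy0 : x = y := by
    refine PiLp.ext fun j ↦ ?_
    rw [Subsingleton.elim j 0, ← sign_mul_abs (x 0), ← sign_mul_abs (y 0), hs, habs x hx,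
      habs y hy]
  rw [hxy0, sub_self, norm_zero]
  exact hε

lemma gaussianMatrixLaw_not_recovery_dim_one {m k : ℕ} {ε : ℝ} (hε : 0 ≤ ε) (hm : 0 < m) :
    gaussianMatrixLaw m 1
      {a : Fin m → Fin 1 → ℝ | ¬ IsUniversalApproxRecovery (Matrix.of a) k ε} = 0 := by
  refine measure_mono_null (t := Set.univ.pi fun _ ↦ Set.univ.pi fun _ ↦ {0}) ?_ ?_
  · intro a ha i _ j _
    by_contra h
    rw [Subsingleton.elim j 0] at h
    exact ha (isUniversalApproxRecovery_of_entry_ne_zero hε a i h)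
  · have := nullSingletonClass_gaussianReal (μ := 0) (one_ne_zero (α := NNReal))
    simp [gaussianMatrixLaw, Measure.pi_pi, hm.ne']

lemma div_sq_le_sq_ratio {n k : ℕ} {ε : ℝ} (hk : 1 ≤ k) (hkn : k ≤ n) (hε : 0 < ε) :
    (n : ℝ) / ε ^ 2 ≤ ((n : ℝ) ^ (3 / 2 : ℝ) / (k * ε)) ^ 2 := by
  have hk' : (0 : ℝ) < k := by exact_mod_cast hk
  have hkn' : (k : ℝ) ≤ n := by exact_mod_cast hkn
  have hn : ((n : ℝ) ^ (3 / 2 : ℝ)) ^ 2 = n ^ 3 := by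
    rw [← Real.rpow_natCast, ← Real.rpow_mul (Nat.cast_nonneg n), ← Real.rpow_natCast]
    norm_num
  rw [div_pow, hn, div_le_div_iff₀ (by positivity) (by positivity)]
  have : (k : ℝ) ^ 2 ≤ n ^ 2 := by gcongr
  calc (n : ℝ) * (k * ε) ^ 2 = n * ε ^ 2 * k ^ 2 := by ring
    _ ≤ n * ε ^ 2 * n ^ 2 := by gcongr
    _ = _ := by ring

lemma one_lt_ratio {n k : ℕ} {ε : ℝ} (hk : 1 ≤ k) (hkn : k ≤ n) (hε : 0 < ε) (hε1 : ε < 1) :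
    1 < (n : ℝ) ^ (3 / 2 : ℝ) / (k * ε) := by
  have hk' : (0 : ℝ) < k := by exact_mod_cast hk
  have hn' : (1 : ℝ) ≤ n := by exact_mod_cast hk.trans hkn
  have h : 1 < (n : ℝ) / ε ^ 2 := by
    rw [one_lt_div (by positivity)]
    nlinarith
  exact lt_of_pow_lt_pow_left₀ 2 (by positivity)
    (by simpa using h.trans_le (div_sq_le_sq_ratio hk hkn hε))

/-- The logarithm of the base of the net cardinality is at most a multiple of
`log (n ^ (3 / 2) / (k ε))`. -/
lemma log_net_card_le {n k : ℕ} {ε B : ℝ} (hk : 1 ≤ k) (hkn : k ≤ n) (hn : 2 ≤ n) (hε : 0 < ε)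
    (hε1 : ε < 1) (hB : 1 ≤ B) :
    Real.log (n * (2 * (⌈B * n / ε ^ 2⌉₊ : ℕ) + 1)) ≤
      (2 * Real.log (2 * B + 3) / Real.log 2 + 4) *
        Real.log ((n : ℝ) ^ (3 / 2 : ℝ) / (k * ε)) := by
  set Q := (n : ℝ) ^ (3 / 2 : ℝ) / (k * ε) with hQ
  have hQ1 : 1 < Q := one_lt_ratio hk hkn hε hε1
  have hQ2 : (n : ℝ) / ε ^ 2 ≤ Q ^ 2 := div_sq_le_sq_ratio hk hkn hε
  have hn' : (2 : ℝ) ≤ n := by exact_mod_cast hn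
  have hnε : (n : ℝ) ≤ n / ε ^ 2 := by
    rw [le_div_iff₀ (by positivity)]
    exact mul_le_of_le_one_right (by positivity) (pow_le_one₀ hε.le hε1.le)
  have hM : ((⌈B * n / ε ^ 2⌉₊ : ℕ) : ℝ) ≤ B * Q ^ 2 + 1 := by
    refine (Nat.ceil_lt_add_one (by positivity)).le.trans ?_
    rw [mul_div_assoc]
    gcongr
  have hbase : (n : ℝ) * (2 * (⌈B * n / ε ^ 2⌉₊ : ℕ) + 1) ≤ (2 * B + 3) * Q ^ 4 := by
    calc (n : ℝ) * (2 * (⌈B * n / ε ^ 2⌉₊ : ℕ) + 1)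
        ≤ Q ^ 2 * (2 * (B * Q ^ 2 + 1) + 1) := by gcongr; exact hnε.trans hQ2
      _ ≤ (2 * B + 3) * Q ^ 4 := by nlinarith [sq_nonneg Q, one_lt_pow₀ hQ1 two_ne_zero]
  -- `n ≥ 2` keeps `log Q` away from `0`, which lets it absorb the constant `log (2 B + 3)`.
  have hlog2 : Real.log 2 ≤ 2 * Real.log Q := by
    calc Real.log 2 ≤ Real.log (Q ^ 2) :=
          Real.log_le_log two_pos ((hn'.trans hnε).trans hQ2)
      _ = 2 * Real.log Q := by rw [Real.log_pow]; norm_num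
  have hB0 : 0 ≤ Real.log (2 * B + 3) := Real.log_nonneg (by linarith)
  have hl2 : 0 < Real.log 2 := Real.log_pos one_lt_two
  calc _ ≤ Real.log ((2 * B + 3) * Q ^ 4) := Real.log_le_log (by positivity) hbase
    _ = Real.log (2 * B + 3) + 4 * Real.log Q := by
        rw [Real.log_mul (by positivity) (by positivity), Real.log_pow]; norm_num
    _ ≤ Real.log (2 * B + 3) / Real.log 2 * (2 * Real.log Q) + 4 * Real.log Q := by
        gcongr
        calc Real.log (2 * B + 3) = Real.log (2 * B + 3) / Real.log 2 * Real.log 2 := by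
              field_simp
          _ ≤ _ := by gcongr
    _ = _ := by ring

lemma exists_gaussianMatrixLaw_not_recovery_le_exp :
    ∃ C : ℝ, 0 < C ∧ ∀ (n k m : ℕ) (ε : ℝ), 1 ≤ k → k ≤ n → 0 < ε → ε < 1 → 0 < m →
      C * ((k : ℝ) / ε * Real.log ((n : ℝ) ^ (3 / 2 : ℝ) / ((k : ℝ) * ε))) ≤ (m : ℝ) →
        gaussianMatrixLaw m n
            {a : Fin m → Fin n → ℝ | ¬ IsUniversalApproxRecovery (Matrix.of a) k ε} ≤
          ENNReal.ofReal (Real.exp (-(ε * (m : ℝ) / C))) := by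
  obtain ⟨c, B, hc, hB, h⟩ := exists_gaussianMatrixLaw_not_recovery_le
  set K : ℝ := 2 * Real.log (2 * B + 3) / Real.log 2 + 4 with hK
  have hK4 : 4 ≤ K := by
    have h1 : 0 ≤ Real.log (2 * B + 3) := Real.log_nonneg (by linarith)
    have h2 : 0 < Real.log 2 := Real.log_pos one_lt_two
    have : 0 ≤ 2 * Real.log (2 * B + 3) / Real.log 2 := by positivity
    linarith
  -- With this `C` the net entropy `2 k log W` uses at most half of `c ε m`; the other half exceeds
  -- `ε m / C`, as `K ≥ 4`.
  refine ⟨4 * K / c, by positivity, ?_⟩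
  intro n k m ε hk hkn hε hε1 hm0 hm
  rcases (hk.trans hkn).eq_or_lt with rfl | hn
  · rw [gaussianMatrixLaw_not_recovery_dim_one hε.le hm0]
    exact zero_le
  set Q := (n : ℝ) ^ (3 / 2 : ℝ) / (k * ε) with hQ
  have hn' : (0 : ℝ) < n := by exact_mod_cast hk.trans hkn
  have hMpos : 0 < B * n / ε ^ 2 := by positivity
  have hlog := log_net_card_le hk hkn hn hε hε1 hB
  -- The grid parameter `M = ⌈B n / ε ^ 2⌉` meets the mesh condition and stays polynomial in `n /
  -- ε`.
  have hnM : B * (n : ℝ) ^ 2 ≤ ε ^ 3 * ((⌈B * n / ε ^ 2⌉₊ : ℕ) : ℝ) ^ 2 := by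
    calc B * (n : ℝ) ^ 2 ≤ B ^ 2 * n ^ 2 / ε := by
          rw [le_div_iff₀ hε]
          have h1 : B * ε ≤ B ^ 2 := by nlinarith
          nlinarith [sq_nonneg (n : ℝ)]
      _ = ε ^ 3 * (B * n / ε ^ 2) ^ 2 := by field_simp
      _ ≤ _ := by gcongr; exact Nat.le_ceil _
  refine (h n k m _ ε (hk.trans hkn) (Nat.ceil_pos.2 hMpos) hε hε1 hnM).trans
    (ENNReal.ofReal_le_ofReal ?_)
  set W : ℝ := n * (2 * (⌈B * n / ε ^ 2⌉₊ : ℕ) + 1) with hW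
  have hW0 : 0 < W := by positivity
  have hWk : (W ^ k) ^ 2 = Real.exp (2 * k * Real.log W) := by
    rw [← Real.exp_log hW0, ← Real.exp_nat_mul, ← Real.exp_nat_mul, Real.log_exp]
    congr 1; push_cast; ring
  rw [hWk, ← Real.exp_add]
  refine Real.exp_le_exp.2 ?_
  have hm' : 4 * K * (k * Real.log Q) ≤ c * (ε * m) := by
    calc 4 * K * (k * Real.log Q) = c * ε * (4 * K / c * (k / ε * Real.log Q)) := by field_simp
      _ ≤ c * ε * m := by gcongr
      _ = _ := by ring
  have hkl : 2 * k * Real.log W ≤ 2 * k * (K * Real.log Q) := by gcongr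
  have hC : ε * m / (4 * K / c) ≤ c * (ε * m) / 16 := by
    rw [div_div_eq_mul_div, mul_comm c, div_le_div_iff_of_pos_left (by positivity)
      (by positivity) (by positivity)]
    linarith
  have : 0 ≤ c * (ε * m) := by positivity
  linarith

end Probability

/-- There is a universal constant `C > 0` such that for all `1 ≤ k ≤ n`, all `0 < ε < 1` and all
`m ≥ C (k / ε) log (n^(3/2) / (k ε))`, a universal `ε`-approximate recovery matrix with `m` rows
exists, and an `m × n` matrix with i.i.d. `N(0,1)` entries fails to be one with (outer) probability
at most `exp (- ε m / C)`, which by the lower bound on `m` is at most `(k ε / n^(3/2)) ^ k`. -/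
theorem mainTheorem2 :
    ∃ C : ℝ, 0 < C ∧
      ∀ (n k m : ℕ) (ε : ℝ), 1 ≤ k → k ≤ n → 0 < ε → ε < 1 →
        C * ((k : ℝ) / ε * Real.log ((n : ℝ) ^ (3 / 2 : ℝ) / ((k : ℝ) * ε))) ≤ (m : ℝ) →
          (∃ A : Matrix (Fin m) (Fin n) ℝ, IsUniversalApproxRecovery A k ε) ∧
          gaussianMatrixLaw m n
              {a : Fin m → Fin n → ℝ | ¬ IsUniversalApproxRecovery (Matrix.of a) k ε} ≤
            ENNReal.ofReal (Real.exp (-(ε * (m : ℝ) / C))) := by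
  obtain ⟨C, hC, h⟩ := exists_gaussianMatrixLaw_not_recovery_le_exp
  refine ⟨C, hC, fun n k m ε hk hkn hε hε1 hm ↦ ?_⟩
  have hk' : (0 : ℝ) < k := by exact_mod_cast hk
  have hlog := Real.log_pos (one_lt_ratio hk hkn hε hε1)
  have hm0 : (0 : ℝ) < m := lt_of_lt_of_le (by positivity) hm
  have hle := h n k m ε hk hkn hε hε1 (by exact_mod_cast hm0) hm
  refine ⟨?_, hle⟩
  -- Since `m > 0`, the failure bound is strictly below `1`, so not every matrix fails.
  by_contra! hno
  have huniv : {a : Fin m → Fin n → ℝ | ¬ IsUniversalApproxRecovery (Matrix.of a) k ε} =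
      Set.univ := Set.eq_univ_of_forall fun a ↦ hno _
  have hprob : gaussianMatrixLaw m n Set.univ = 1 := by
    rw [gaussianMatrixLaw]
    exact measure_univ
  rw [huniv, hprob, ENNReal.one_le_ofReal, Real.one_le_exp_iff] at hle
  have : 0 < ε * m / C := by positivity
  linarith
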